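/- Let $d\ge 1$, let $|\cdot|$ be the Euclidean norm on $\mathbb{R}^d$, and let $X=(\mathbb{R}^d\setminus\{0\})/\mathbb{R}_{>0}$ be the compact space of directions, writing $\overline{x}$ for the class of $x\neq 0$. Let $\mathscr{C}^{\times}_{\mathrm{hom}}(\mathbb{R}^d)$ be the set of continuous maps $f:\mathbb{R}^d\to\mathbb{R}^d$ with $f(ax)=af(x)$ for all $a>0$, $x\in\mathbb{R}^d$, and $f(x)\neq0$ for all $x\neq0$, with the metric $d(f,g)=\sup_{|x|=1}|f(x)-g(x)|$. Each such $f$ acts on $X$ by $f.\overline{x}=\overline{f(x)}$; put $c_{\mathrm{hom}}(f,\overline{x})=\log\frac{|f(x)|}{|x|}$. For a Borel probability measure $\eta$ on $\mathscr{C}^{\times}_{\mathrm{hom}}(\mathbb{R}^d)$, a Borel probability measure $\nu$ on $X$ is called spherical $\eta$-stationary if $\int_X\int h(f.\overline{x})\,d\eta(f)\,d\nu(\overline{x})=\int_X h\,d\nu$ for every continuous $h:X\to\mathbb{R}$. (1) Law of large numbers for positively homogeneous maps. Let $\eta$ be a Borel probability measure on $\mathscr{C}^{\times}_{\mathrm{hom}}(\mathbb{R}^d)$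 that has a unique spherical $\eta$-stationary probability measure and satisfies $\int\sup_{\overline{x}\in X}|c_{\mathrm{hom}}(f,\overline{x})|\,d\eta(f)<\infty$. Let $f_1,f_2,\dots$ be the coordinates of $\omega$ in the product space $(\mathscr{C}^{\times}_{\mathrm{hom}}(\mathbb{R}^d)^{\mathbb{N}},\mathbb{P}_\eta=\eta^{\otimes\mathbb{N}})$, and let $X_0=x_0$, $X_\ell=f_\ell(X_{\ell-1})$. Then there is a real number $\lambda_\eta$ such that for every $x_0\in\mathbb{R}^d\setminus\{0\}$, $\frac1\ell\log|X_\ell|\to\lambda_\eta$ as $\ell\to\infty$ for $\mathbb{P}_\eta$-almost every $\omega$; moreover $$\lim_{\ell\to\infty}\ \sup_{x_0\in\mathbb{R}^d\setminus\{0\}}\mathbb{E}\left[\left|\tfrac1\ell\left(\log|X_\ell|-\log|x_0|\right)-\lambda_\eta\right|\right]=0;$$ and if $\nu$ is the unique spherical $\eta$-stationary probability measure, then $c_{\mathrm{hom}}$ is $\eta\otimes\nu$-integrable and $\lambda_\eta=\int c_{\mathrm{hom}}(f,\overline{x})\,d(\eta\otimes\nu)(f,\overline{x})$. (2) Law of large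 numbers for generalized Leaky ReLU networks. Let $\alpha_1,\alpha_2\in\mathbb{R}\setminus\{0\}$ and $\phi(t)=\max(\alpha_1t,\alpha_2t)$, applied coordinatewise to vectors. For $W\in\mathrm{GL}_d(\mathbb{R})$ let $\phi_W\in\mathscr{C}^{\times}_{\mathrm{hom}}(\mathbb{R}^d)$ be $\phi_W(x)=\phi(Wx)$, and let $N(W)=\max(\|W\|,\|W^{-1}\|)$ with the Euclidean operator norm. Let $\mu$ be a Borel probability measure on $\mathrm{GL}_d(\mathbb{R})$ with $\int\log N(W)\,d\mu(W)<\infty$ that has a unique spherical $\mu$-stationary probability measure, i.e. a unique Borel probability measure $\nu$ on $X$ with $\int_X\int h(\phi_W.\overline{x})\,d\mu(W)\,d\nu(\overline{x})=\int_X h\,d\nu$ for every continuous $h:X\to\mathbb{R}$. Let $W_1,W_2,\dots$ be the coordinates of $\omega$ in $(\mathrm{GL}_d(\mathbb{R})^{\mathbb{N}},\mathbb{P}_\mu=\mu^{\otimes\mathbb{N}})$, and let $X_0=x_0$, $X_\ell=\phi(W_\ell X_{\ell-1})$. Then there is a real number $\lambda_{\mu,\phi}$ such that for every $x_0\in\mathbb{R}^d\setminus\{0\}$,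 $\frac1\ell\log|X_\ell|\to\lambda_{\mu,\phi}$ as $\ell\to\infty$ for $\mathbb{P}_\mu$-almost every $\omega$; moreover $$\lim_{\ell\to\infty}\ \sup_{x_0\in\mathbb{R}^d\setminus\{0\}}\mathbb{E}\left[\left|\tfrac1\ell\left(\log|X_\ell|-\log|x_0|\right)-\lambda_{\mu,\phi}\right|\right]=0;$$ and for the unique spherical $\mu$-stationary probability measure $\nu$, the function $(W,\overline{x})\mapsto\log\frac{|\phi(Wx)|}{|x|}$ is $\mu\otimes\nu$-integrable and $$\lambda_{\mu,\phi}=\int_{\mathrm{GL}_d(\mathbb{R})\times X}\log\frac{|\phi(Wx)|}{|x|}\,d(\mu\otimes\nu)(W,\overline{x}).$$ -/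

import Mathlib

open Filter MeasureTheory Topology
open scoped ENNReal

namespace HomLLN

/-- The Euclidean space `ℝ^d`. -/
abbrev Euc (d : ℕ) : Type := EuclideanSpace ℝ (Fin d)

/-! ### The space of directions `X = (ℝ^d ∖ {0}) / ℝ_{>0}` -/

/-- Nonzero vectors `x, y` are equivalent when `x = r y` for some real `r > 0`. -/
def dirSetoid (d : ℕ) : Setoid {x : Euc d // x ≠ 0} where
  r x y := ∃ r : ℝ, 0 < r ∧ (x : Euc d) = r • (y : Euc d)
  iseqv :=
    { refl := fun x => ⟨1, one_pos, by simp⟩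
      symm := by
        rintro x y ⟨r, hr, h⟩
        exact ⟨r⁻¹, inv_pos.mpr hr, by rw [h, smul_smul, inv_mul_cancel₀ hr.ne', one_smul]⟩
      trans := by
        rintro x y z ⟨r, hr, h⟩ ⟨s, hs, h'⟩
        exact ⟨r * s, mul_pos hr hs, by rw [h, h', smul_smul]⟩ }

/-- The space `X = (ℝ^d ∖ {0}) / ℝ_{>0}` of directions of `ℝ^d`. -/
def Dir (d : ℕ) : Type := Quotient (dirSetoid d)

/-- The quotient topology. -/
instance (d : ℕ) : TopologicalSpace (Dir d) :=
  inferInstanceAs (TopologicalSpace (Quotient (dirSetoid d)))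

/-- The Borel `σ`-algebra of the quotient topology. -/
instance (d : ℕ) : MeasurableSpace (Dir d) := borel _

instance (d : ℕ) : BorelSpace (Dir d) := ⟨rfl⟩

/-! ### Nonvanishing continuous positively homogeneous maps -/

/-- The set of continuous positively homogeneous maps `f : ℝ^d → ℝ^d` with `f x ≠ 0` for all
`x ≠ 0`. -/
structure PosHom (d : ℕ) where
  /-- the underlying function -/
  toFun : Euc d → Euc d
  cont : Continuous toFun
  hom : ∀ (a : ℝ) (x : Euc d), 0 < a → toFun (a • x) = a • toFun x
  ne_zero : ∀ x : Euc d, x ≠ 0 → toFun x ≠ 0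

namespace PosHom

variable {d : ℕ}

/-- Restriction to the unit sphere. -/
def onSphere (f : PosHom d) : C(Metric.sphere (0 : Euc d) 1, Euc d) :=
  ⟨fun x => f.toFun x, f.cont.comp continuous_subtype_val⟩

theorem map_zero (f : PosHom d) : f.toFun 0 = 0 := by
  have h := f.hom 2 0 two_pos
  rw [smul_zero, two_smul] at h
  simpa using h

theorem onSphere_injective : Function.Injective (onSphere (d := d)) := by
  intro f g h
  have key : f.toFun = g.toFun := by
    funext x
    rcases eq_or_ne x 0 with rfl | hx
    · rw [f.map_zero, g.map_zero]
    · have hn : 0 < ‖x‖ := norm_pos_iff.mpr hx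
      have hu : ‖x‖⁻¹ • x ∈ Metric.sphere (0 : Euc d) 1 := by
        simp [norm_smul, hn.ne']
      have h1 : f.toFun (‖x‖⁻¹ • x) = g.toFun (‖x‖⁻¹ • x) :=
        DFunLike.congr_fun h ⟨_, hu⟩
      have hx' : x = ‖x‖ • (‖x‖⁻¹ • x) := by
        rw [smul_smul, mul_inv_cancel₀ hn.ne', one_smul]
      rw [hx', f.hom _ _ hn, g.hom _ _ hn, h1]
  cases f; cases g; simp_all

/-- The metric `dist f g = sup_{|x| = 1} |f x - g x|`. -/
noncomputable instance : MetricSpace (PosHom d) :=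
  MetricSpace.induced onSphere onSphere_injective inferInstance

/-- The Borel `σ`-algebra. -/
noncomputable instance : MeasurableSpace (PosHom d) := borel _

instance : BorelSpace (PosHom d) := ⟨rfl⟩

/-- The action of `f` on directions: the direction of `x` is sent to the direction of `f x`. -/
def act (f : PosHom d) : Dir d → Dir d :=
  Quotient.map (fun x : {x : Euc d // x ≠ 0} =>
      (⟨f.toFun x, f.ne_zero x x.2⟩ : {x : Euc d // x ≠ 0})) (by
    rintro x y ⟨r, hr, h⟩
    exact ⟨r, hr, by simp only [h, f.hom r _ hr]⟩)

/-- The cocycle `c(f, x̄) = log (|f x| / |x|)`, for any representative `x` of the direction `x̄`. -/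
noncomputable def cocycle (f : PosHom d) : Dir d → ℝ :=
  Quotient.lift (fun x : {x : Euc d // x ≠ 0} =>
      Real.log (‖f.toFun (x : Euc d)‖ / ‖(x : Euc d)‖)) (by
    rintro x y ⟨r, hr, h⟩
    simp only [h, f.hom r _ hr, norm_smul]
    rw [mul_div_mul_left _ _ (norm_ne_zero_iff.mpr hr.ne')])

end PosHom

/-! ### Random compositions and stationary measures

Both the random composition of maps drawn from a law on `PosHom d` itself and that of network layers
indexed by a random weight are covered by a family `F : G → PosHom d`. -/

section Random

variable {d : ℕ} {G : Type*}

/-- `X_0 = x₀` and `X_{ℓ+1} = F_{ω_ℓ} (X_ℓ)`; the entry `ω ℓ` is the parameter of layer `ℓ + 1`. -/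
def orbit (F : G → PosHom d) (ω : ℕ → G) (x₀ : Euc d) : ℕ → Euc d
  | 0 => x₀
  | ℓ + 1 => (F (ω ℓ)).toFun (orbit F ω x₀ ℓ)

/-- `ν` is `μ`-stationary on the space of directions, i.e. `μ * ν = ν`, where `μ * ν` is the measure
determined by `(μ * ν)(h) = ∫∫ h (g • x) dμ(g) dν(x)` for continuous `h`. -/
def IsSphericalStationary [MeasurableSpace G] (F : G → PosHom d) (μ : Measure G) (ν : Measure (Dir d)) :
    Prop :=
  ∀ h : C(Dir d, ℝ), ∫ x, ∫ g, h ((F g).act x) ∂μ ∂ν = ∫ x, h x ∂ν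

end Random

/-! ### Leaky ReLU layers with invertible weights -/

section Leaky

variable {d : ℕ}

/-- The Borel `σ`-algebra of the usual topology of `GL_d(ℝ)`. -/
noncomputable instance : MeasurableSpace (GL (Fin d) ℝ) := borel _

instance : BorelSpace (GL (Fin d) ℝ) := ⟨rfl⟩

/-- The generalized Leaky ReLU activation `φ(t) = max (α₁ t) (α₂ t)`. -/
def leaky (α₁ α₂ t : ℝ) : ℝ := max (α₁ * t) (α₂ * t)

theorem leaky_ne_zero {α₁ α₂ t : ℝ} (h₁ : α₁ ≠ 0) (h₂ : α₂ ≠ 0) (ht : t ≠ 0) :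
    leaky α₁ α₂ t ≠ 0 := by
  unfold leaky
  rcases max_choice (α₁ * t) (α₂ * t) with h | h <;> rw [h] <;> positivity

/-- One network layer `x ↦ φ (W x)`, with `φ` applied coordinatewise. -/
noncomputable def layerFun (α₁ α₂ : ℝ) (W : GL (Fin d) ℝ) (x : Euc d) : Euc d :=
  WithLp.toLp 2 fun i => leaky α₁ α₂ (Matrix.mulVec (W : Matrix (Fin d) (Fin d) ℝ) x.ofLp i)

/-- The layer `x ↦ φ (W x)` as a nonvanishing continuous positively homogeneous map. -/
noncomputable def layer {α₁ α₂ : ℝ} (h₁ : α₁ ≠ 0) (h₂ : α₂ ≠ 0) (W : GL (Fin d) ℝ) :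
    PosHom d where
  toFun := layerFun α₁ α₂ W
  cont := by
    unfold layerFun leaky Matrix.mulVec dotProduct
    fun_prop
  hom a x ha := by
    ext i
    simp only [layerFun, leaky, WithLp.ofLp_smul, Matrix.mulVec_smul, Pi.smul_apply, smul_eq_mul]
    rw [mul_left_comm, mul_left_comm α₂, ← mul_max_of_nonneg _ _ ha.le]
  ne_zero x hx h := by
    apply hx
    have hW : Matrix.mulVec (W : Matrix (Fin d) (Fin d) ℝ) x.ofLp = 0 := by
      funext i
      by_contra hi
      exact leaky_ne_zero h₁ h₂ hi (by simpa [layerFun] using congrArg (fun y : Euc d => y i) h)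
    have hx0 : x.ofLp = 0 := by
      have := congrArg (Matrix.mulVec ((W⁻¹ : GL (Fin d) ℝ) : Matrix (Fin d) (Fin d) ℝ)) hW
      rwa [Matrix.mulVec_mulVec, Units.inv_mul, Matrix.one_mulVec, Matrix.mulVec_zero] at this
    ext i
    simpa using congrFun hx0 i

/-- `N(W) = max (‖W‖, ‖W⁻¹‖)` for the Euclidean operator norm. -/
noncomputable def normN (W : GL (Fin d) ℝ) : ℝ :=
  max ‖Matrix.toEuclideanCLM (𝕜 := ℝ) (W : Matrix (Fin d) (Fin d) ℝ)‖
    ‖Matrix.toEuclideanCLM (𝕜 := ℝ) ((W⁻¹ : GL (Fin d) ℝ) : Matrix (Fin d) (Fin d) ℝ)‖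

end Leaky

end HomLLN

open HomLLN

/-!
The norm growth of a random product of positively homogeneous maps is an additive functional of a
Markov chain on the compact space of directions `X`: `log |X_ℓ| - log |x₀|` is the sum of the
cocycle `σ(g, x) = log (|F_g x| / |x|)` along the walk of directions (`log_norm_orbit_sub`). Both
laws of large numbers are instances of one statement about a measurable family `F : G → PosHom d` with
an i.i.d. parameter (`lln_of_measurable_family`), with `F` the identity or the map from a weight to its
layer.

Let `P h (x) = ∫ h (a_g x) dμ(g)` be the averaging operator on `C(X)`. Since the stationary measure
`ν` is unique and `X` is compact, the averages of `P^k ψ` converge uniformly to `∫ ψ dν`, hence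
every `ψ ∈ C(X)` is uniformly `ε`-close to `∫ ψ dν + h - P h` for some `h ∈ C(X)`
(`exists_coboundary_close`). Let `s(g, x)` be the cocycle truncated where its integrable bound
`Z(g) = sup_x |σ(g, x)|` is large, and apply this to its mean `ψ(x) = ∫ s(g, x) dμ(g)`. The centred
cocycle sum becomes the sum of bounded martingale differences
`τ(g, x) = s(g, x) - ψ(x) + h(a_g x) - P h(x)`, of a telescoping sum of `h`, and of an error that is
at most `ε` per step plus an i.i.d. sum of the tail of `Z` (`exists_walkSum_approx`).

The martingale part is negligible because orthogonality of the increments bounds its second moment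
linearly in the number of steps, uniformly in the starting point (`integral_walkSum_sq_le`). This
gives convergence in mean at once, and almost sure convergence along the squares, hence along all
integers, the increments being bounded (`ae_tendsto_walkSum_div`). The tail of `Z` is controlled by
the classical strong law of large numbers.
-/

namespace HomLLN

/-! ### Random walks driven by an i.i.d. sequence -/

section Walk

variable {G X : Type*}

/-- The sequence with first entry `g` followed by the entries of `ω`. -/
def consSeq (g : G) (ω : ℕ → G) : ℕ → G
  | 0 => g
  | n + 1 => ω n

/-- The random walk `x, a_{ω_0} x, a_{ω_1} a_{ω_0} x, …` on `X`. -/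
def walk (a : G → X → X) (ω : ℕ → G) (x : X) : ℕ → X
  | 0 => x
  | n + 1 => a (ω n) (walk a ω x n)

/-- The additive functional `∑_{k < n} τ (ω_k, X_k)` of the walk `X` started at `x`. -/
def walkSum (a : G → X → X) (τ : G → X → ℝ) (ω : ℕ → G) (x : X) (n : ℕ) : ℝ :=
  ∑ k ∈ Finset.range n, τ (ω k) (walk a ω x k)

theorem walk_consSeq (a : G → X → X) (g : G) (ω : ℕ → G) (x : X) (n : ℕ) :
    walk a (consSeq g ω) x (n + 1) = walk a ω (a g x) n := by
  induction n with
  | zero => rfl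
  | succ n ih => rw [walk, ih]; rfl

theorem walkSum_consSeq (a : G → X → X) (τ : G → X → ℝ) (g : G) (ω : ℕ → G) (x : X) (n : ℕ) :
    walkSum a τ (consSeq g ω) x (n + 1) = τ g x + walkSum a τ ω (a g x) n := by
  unfold walkSum
  rw [Finset.sum_range_succ', add_comm]
  simp only [walk_consSeq]
  rfl

variable [MeasurableSpace G] [MeasurableSpace X]

theorem measurable_consSeq : Measurable fun p : G × (ℕ → G) => consSeq p.1 p.2 := by
  refine measurable_pi_lambda _ fun n => ?_
  cases n with
  | zero => exact measurable_fst
  | succ n => exact (measurable_pi_apply n).comp measurable_snd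

/-- Prepending an independent entry of law `μ` to an i.i.d. sequence of law `μ` gives an i.i.d.
sequence of law `μ`. -/
theorem measurePreserving_consSeq (μ : Measure G) [IsProbabilityMeasure μ] :
    MeasurePreserving (fun p : G × (ℕ → G) => consSeq p.1 p.2)
      (μ.prod (Measure.infinitePi fun _ : ℕ => μ)) (Measure.infinitePi fun _ : ℕ => μ) := by
  refine ⟨measurable_consSeq, Measure.eq_infinitePi _ fun s t ht => ?_⟩
  rw [Measure.map_apply measurable_consSeq (.pi s.countable_toSet fun i _ => ht i)]
  have hinj : Set.InjOn Nat.succ (Nat.succ ⁻¹' (s : Set ℕ)) := Nat.succ_injective.injOn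
  have hset : (fun p : G × (ℕ → G) => consSeq p.1 p.2) ⁻¹' (s : Set ℕ).pi t =
      (if 0 ∈ s then t 0 else Set.univ) ×ˢ
        ((s.preimage Nat.succ hinj : Finset ℕ) : Set ℕ).pi fun n => t (n + 1) := by
    ext p
    simp only [Set.mem_preimage, Set.mem_pi, Set.mem_prod, SetLike.mem_coe, Finset.mem_preimage]
    constructor
    · intro h
      refine ⟨?_, fun n hn => h (n + 1) hn⟩
      split_ifs with h0
      · exact h 0 h0
      · trivial
    · rintro ⟨h0, h1⟩ n hn
      cases n with
      | zero => rw [if_pos hn] at h0; exact h0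
      | succ n => exact h1 n hn
  rw [hset, Measure.prod_prod, Measure.infinitePi_pi _ fun i _ => ht (i + 1)]
  have hprod := Finset.prod_preimage Nat.succ s hinj (fun n => if n = 0 then 1 else μ (t n))
    (by intro n _ hn; cases n with
      | zero => simp
      | succ n => exact absurd ⟨n, rfl⟩ hn)
  simp only [Nat.succ_ne_zero, if_false, Nat.succ_eq_add_one] at hprod
  rw [hprod]
  by_cases h0 : 0 ∈ s
  · rw [if_pos h0, ← Finset.mul_prod_erase s _ h0, ← Finset.mul_prod_erase s _ h0, if_pos rfl,
      one_mul]
    congr 1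
    exact Finset.prod_congr rfl fun n hn => if_neg (Finset.ne_of_mem_erase hn)
  · rw [if_neg h0, measure_univ, one_mul]
    exact Finset.prod_congr rfl fun n hn => if_neg fun (h : n = 0) => h0 (h ▸ hn)

theorem measurable_walk {a : G → X → X} (ha : Measurable (Function.uncurry a)) (n : ℕ) :
    Measurable fun p : (ℕ → G) × X => walk a p.1 p.2 n := by
  induction n with
  | zero => exact measurable_snd
  | succ n ih => exact ha.comp (((measurable_pi_apply n).comp measurable_fst).prodMk ih)

theorem measurable_walkSum {a : G → X → X} (ha : Measurable (Function.uncurry a)) {τ : G → X → ℝ}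
    (hτ : Measurable (Function.uncurry τ)) (n : ℕ) :
    Measurable fun p : (ℕ → G) × X => walkSum a τ p.1 p.2 n :=
  Finset.measurable_sum _ fun k _ =>
    hτ.comp (((measurable_pi_apply k).comp measurable_fst).prodMk (measurable_walk ha k))

omit [MeasurableSpace G] [MeasurableSpace X] in
theorem abs_walkSum_le {a : G → X → X} {τ : G → X → ℝ} {C : ℝ} (hC : ∀ g x, |τ g x| ≤ C)
    (ω : ℕ → G) (x : X) (n : ℕ) : |walkSum a τ ω x n| ≤ n * C := by
  refine (Finset.abs_sum_le_sum_abs _ _).trans ((Finset.sum_le_sum fun k _ => hC _ _).trans ?_)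
  simp

theorem integrable_walkSum_pow {μ : Measure G} [IsProbabilityMeasure μ] {a : G → X → X}
    (ha : Measurable (Function.uncurry a)) {τ : G → X → ℝ}
    (hτ : Measurable (Function.uncurry τ)) {C : ℝ} (hC : ∀ g x, |τ g x| ≤ C) (x : X) (n i : ℕ) :
    Integrable (fun ω => walkSum a τ ω x n ^ i) (Measure.infinitePi fun _ : ℕ => μ) := by
  refine Integrable.of_bound
    (((measurable_walkSum ha hτ n).comp measurable_prodMk_right).pow_const i).aestronglyMeasurable
    ((n * C) ^ i) (ae_of_all _ fun ω => ?_)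
  rw [norm_pow, Real.norm_eq_abs]
  exact pow_le_pow_left₀ (abs_nonneg _) (abs_walkSum_le hC ω x n) i

/-- The first-step decomposition of an integral over the paths of the walk. -/
theorem integral_infinitePi_eq_integral_consSeq {μ : Measure G} [IsProbabilityMeasure μ]
    {f : (ℕ → G) → ℝ} (hf : Integrable f (Measure.infinitePi fun _ : ℕ => μ)) :
    ∫ ω, f ω ∂(Measure.infinitePi fun _ : ℕ => μ) =
      ∫ g, ∫ ω, f (consSeq g ω) ∂(Measure.infinitePi fun _ : ℕ => μ) ∂μ := by
  have hp := measurePreserving_consSeq μ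
  have h := integral_map hp.aemeasurable (by rw [hp.map_eq]; exact hf.aestronglyMeasurable)
  rw [hp.map_eq] at h
  exact h.trans (integral_prod _ (hp.integrable_comp_of_integrable hf))

variable {μ : Measure G} [IsProbabilityMeasure μ] {a : G → X → X}
  (ha : Measurable (Function.uncurry a)) {τ : G → X → ℝ}
  (hτ : Measurable (Function.uncurry τ)) {C : ℝ} (hC : ∀ g x, |τ g x| ≤ C)
  (hmean : ∀ x, ∫ g, τ g x ∂μ = 0)

include ha hτ hC hmean

theorem integral_walkSum_eq_zero (n : ℕ) (x : X) :
    ∫ ω, walkSum a τ ω x n ∂(Measure.infinitePi fun _ : ℕ => μ) = 0 := by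
  induction n generalizing x with
  | zero => simp [walkSum]
  | succ n ih =>
    have hi (m : ℕ) (y : X) : Integrable (fun ω => walkSum a τ ω y m)
        (Measure.infinitePi fun _ : ℕ => μ) := by
      simpa using integrable_walkSum_pow (μ := μ) ha hτ hC y m 1
    rw [integral_infinitePi_eq_integral_consSeq (hi _ _)]
    simp only [walkSum_consSeq]
    rw [← hmean x]
    refine integral_congr_ae (ae_of_all _ fun g => ?_)
    dsimp only
    rw [integral_add (integrable_const _) (hi _ _), ih]
    simp

/-- The increments of a centred additive functional are orthogonal, so that its variance grows at
most linearly. -/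
theorem integral_walkSum_sq_le (n : ℕ) (x : X) :
    ∫ ω, walkSum a τ ω x n ^ 2 ∂(Measure.infinitePi fun _ : ℕ => μ) ≤ n * C ^ 2 := by
  induction n generalizing x with
  | zero => simp [walkSum]
  | succ n ih =>
    have hi (m : ℕ) (y : X) : Integrable (fun ω => walkSum a τ ω y m)
        (Measure.infinitePi fun _ : ℕ => μ) := by
      simpa using integrable_walkSum_pow (μ := μ) ha hτ hC y m 1
    have hi2 (m : ℕ) (y : X) := integrable_walkSum_pow (μ := μ) ha hτ hC y m 2
    rw [integral_infinitePi_eq_integral_consSeq (hi2 _ _)]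
    simp only [walkSum_consSeq]
    have hstep (g : G) : ∫ ω, (τ g x + walkSum a τ ω (a g x) n) ^ 2
        ∂(Measure.infinitePi fun _ : ℕ => μ) ≤ (n + 1 : ℕ) * C ^ 2 := by
      have hexp (ω : ℕ → G) : (τ g x + walkSum a τ ω (a g x) n) ^ 2 =
          (τ g x ^ 2 + 2 * τ g x * walkSum a τ ω (a g x) n) + walkSum a τ ω (a g x) n ^ 2 := by
        ring
      have hi1 : Integrable (fun ω => 2 * τ g x * walkSum a τ ω (a g x) n)
          (Measure.infinitePi fun _ : ℕ => μ) := (hi _ _).const_mul _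
      have hi3 : Integrable (fun ω => τ g x ^ 2 + 2 * τ g x * walkSum a τ ω (a g x) n)
          (Measure.infinitePi fun _ : ℕ => μ) := (integrable_const _).add hi1
      simp only [hexp]
      rw [integral_add hi3 (hi2 _ _), integral_add (integrable_const _) hi1, integral_const_mul,
        integral_walkSum_eq_zero ha hτ hC hmean]
      have h1 : τ g x ^ 2 ≤ C ^ 2 := sq_le_sq' (abs_le.mp (hC g x)).1 (abs_le.mp (hC g x)).2
      have h2 := ih (a g x)
      push_cast
      simp only [integral_const, probReal_univ, one_smul, mul_zero, add_zero]
      linarith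
    refine (integral_mono_of_nonneg (ae_of_all _ fun g => integral_nonneg fun ω => sq_nonneg _)
      (integrable_const (((n + 1 : ℕ) : ℝ) * C ^ 2)) (ae_of_all _ hstep)).trans ?_
    simp

/-- The strong law of large numbers for bounded centred additive functionals. Along the squares the
second moments of the averages are summable; boundedness of the increments fills the gaps. -/
theorem ae_tendsto_walkSum_div (x : X) :
    ∀ᵐ ω ∂(Measure.infinitePi fun _ : ℕ => μ),
      Tendsto (fun n : ℕ => walkSum a τ ω x n / n) atTop (𝓝 0) := by
  set P := Measure.infinitePi fun _ : ℕ => μ with hP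
  have hS (n : ℕ) : Measurable fun ω : ℕ → G => walkSum a τ ω x n :=
    (measurable_walkSum ha hτ n).comp measurable_prodMk_right
  have hmom (k : ℕ) : ∫⁻ ω, ENNReal.ofReal ((walkSum a τ ω x (k ^ 2) / (k ^ 2 : ℕ)) ^ 2) ∂P ≤
      ENNReal.ofReal (C ^ 2 * (1 / (k : ℝ) ^ 2)) := by
    have hi := (integrable_walkSum_pow (μ := μ) ha hτ hC x (k ^ 2) 2).div_const
      (((k ^ 2 : ℕ) : ℝ) ^ 2)
    simp only [← div_pow] at hi
    rw [← ofReal_integral_eq_lintegral_ofReal hi (ae_of_all _ fun ω => sq_nonneg _)]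
    refine ENNReal.ofReal_le_ofReal ?_
    simp only [div_pow, integral_div]
    have h := integral_walkSum_sq_le (μ := μ) ha hτ hC hmean (k ^ 2) x
    rcases eq_or_ne k 0 with rfl | hk
    · simp
    · have hk' : (0 : ℝ) < k := by positivity
      rw [div_le_iff₀ (by positivity)]
      refine h.trans (le_of_eq ?_)
      push_cast
      field_simp
  have hfin : ∫⁻ ω, ∑' k : ℕ, ENNReal.ofReal ((walkSum a τ ω x (k ^ 2) / (k ^ 2 : ℕ)) ^ 2) ∂P ≠
      ∞ := by
    rw [lintegral_tsum fun k => (((hS _).div_const _).pow_const 2).ennreal_ofReal.aemeasurable]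
    refine ne_top_of_le_ne_top ?_ (ENNReal.tsum_le_tsum hmom)
    exact ((Real.summable_one_div_nat_pow.2 one_lt_two).mul_left _).tsum_ofReal_ne_top
  filter_upwards [ae_lt_top' (AEMeasurable.tsum fun k =>
    (((hS _).div_const _).pow_const 2).ennreal_ofReal.aemeasurable) hfin] with ω hω
  have hsq : Tendsto (fun k : ℕ => walkSum a τ ω x (k ^ 2) / (k ^ 2 : ℕ)) atTop (𝓝 0) := by
    have h0 := (ENNReal.tendsto_toReal ENNReal.zero_ne_top).comp
      (ENNReal.tendsto_atTop_zero_of_tsum_ne_top hω.ne)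
    have h1 := h0.sqrt
    refine (tendsto_zero_iff_abs_tendsto_zero _).2 (Tendsto.congr (fun k => ?_) (by simpa using h1))
    simp [Real.sqrt_sq_eq_abs, ENNReal.toReal_ofReal (sq_nonneg _)]
  -- Adding the linear drift `C n` makes the sums monotone in `n`.
  have hmono : Monotone fun n : ℕ => walkSum a τ ω x n + C * n := by
    refine monotone_nat_of_le_succ fun n => ?_
    have := (abs_le.mp (hC (ω n) (walk a ω x n))).1
    simp only [walkSum, Finset.sum_range_succ]
    push_cast
    linarith
  -- Along any `c k → ∞` the drift shifts the limit of the averages by `C`.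
  have hdrift (c : ℕ → ℕ) (hc : Tendsto c atTop atTop)
      (h : Tendsto (fun k => walkSum a τ ω x (c k) / (c k : ℕ)) atTop (𝓝 0)) :
      Tendsto (fun k => (walkSum a τ ω x (c k) + C * (c k : ℕ)) / (c k : ℕ)) atTop (𝓝 C) := by
    have h' := h.add_const C
    rw [zero_add] at h'
    refine h'.congr' ?_
    filter_upwards [hc.eventually_ge_atTop 1] with k hk
    have : ((c k : ℕ) : ℝ) ≠ 0 := by positivity
    field_simp
  have hpow : Tendsto (fun k : ℕ => k ^ 2) atTop atTop := tendsto_pow_atTop two_ne_zero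
  have hlim : Tendsto (fun n : ℕ => (walkSum a τ ω x n + C * n) / n) atTop (𝓝 C) := by
    refine tendsto_div_of_monotone_of_exists_subseq_tendsto_div _ C hmono fun b hb =>
      ⟨fun k => k ^ 2, ?_, hpow, hdrift _ hpow hsq⟩
    have hr : Tendsto (fun k : ℕ => (1 + 1 / (k : ℝ)) ^ 2) atTop (𝓝 1) := by
      simpa using ((tendsto_const_nhds (x := (1 : ℝ))).add
        (tendsto_one_div_atTop_nhds_zero_nat (𝕜 := ℝ))).pow 2
    filter_upwards [hr.eventually_lt_const hb, eventually_ge_atTop 1] with k hk hk1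
    have hk0 : (0 : ℝ) < k := by positivity
    have : (((k + 1) ^ 2 : ℕ) : ℝ) = (1 + 1 / (k : ℝ)) ^ 2 * ((k ^ 2 : ℕ) : ℝ) := by
      push_cast
      field_simp
    rw [this]
    exact mul_le_mul_of_nonneg_right hk.le (by positivity)
  have h' := hlim.sub_const C
  rw [sub_self] at h'
  refine h'.congr' ?_
  filter_upwards [eventually_ge_atTop 1] with n hn
  have : (n : ℝ) ≠ 0 := by positivity
  field_simp
  ring

end Walk

/-! ### Averaging operators and unique stationary measures -/

section Markov

variable {G X : Type*} [MeasurableSpace G] [TopologicalSpace X] [CompactSpace X]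
  [MeasurableSpace X] [BorelSpace X]

theorem integrable_continuousMap (ν : Measure X) [IsFiniteMeasure ν] (f : C(X, ℝ)) :
    Integrable (fun x => f x) ν :=
  Integrable.of_bound (f.continuous.measurable.aestronglyMeasurable) ‖f‖
    (ae_of_all _ fun x => f.norm_coe_le_norm x)

variable (μ : Measure G) [IsProbabilityMeasure μ] {a : G → X → X}

theorem integrable_continuousMap_comp (ha : Measurable (Function.uncurry a)) (f : C(X, ℝ)) (x : X) :
    Integrable (fun g => f (a g x)) μ :=
  Integrable.of_bound
    (f.continuous.measurable.comp (ha.comp measurable_prodMk_right)).aestronglyMeasurable ‖f‖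
    (ae_of_all _ fun _ => f.norm_coe_le_norm _)

variable [SecondCountableTopology X]

/-- The averaging operator `(P f) x = ∫ f (a_g x) dμ(g)`, a Feller operator because every `a_g` is
continuous. -/
noncomputable def markovOp (ha : Measurable (Function.uncurry a)) (hac : ∀ g, Continuous (a g)) :
    C(X, ℝ) →ₗ[ℝ] C(X, ℝ) where
  toFun f :=
    ⟨fun x => ∫ g, f (a g x) ∂μ,
      continuous_of_dominated
        (fun x => (integrable_continuousMap_comp μ ha f x).aestronglyMeasurable)
        (fun _ => ae_of_all _ fun _ => f.norm_coe_le_norm _) (integrable_const _)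
        (ae_of_all _ fun g => f.continuous.comp (hac g))⟩
  map_add' f g := by
    ext x
    exact integral_add (integrable_continuousMap_comp μ ha f x)
      (integrable_continuousMap_comp μ ha g x)
  map_smul' c f := by
    ext x
    exact integral_const_mul c _

theorem markovOp_apply (ha : Measurable (Function.uncurry a)) (hac : ∀ g, Continuous (a g))
    (f : C(X, ℝ)) (x : X) : markovOp μ ha hac f x = ∫ g, f (a g x) ∂μ := rfl

/-- The law `μ * ρ` after one step of the walk from the initial law `ρ`. -/
noncomputable def stepLaw (a : G → X → X) (ρ : Measure X) : Measure X :=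
  (μ.prod ρ).map (Function.uncurry a)

variable {μ}

omit [TopologicalSpace X] [CompactSpace X] [BorelSpace X] [SecondCountableTopology X] in
theorem isProbabilityMeasure_stepLaw_iterate (ha : Measurable (Function.uncurry a)) {ρ : Measure X}
    [IsProbabilityMeasure ρ] (k : ℕ) : IsProbabilityMeasure ((stepLaw μ a)^[k] ρ) := by
  induction k with
  | zero => assumption
  | succ k ih =>
    rw [Function.iterate_succ_apply']
    exact Measure.isProbabilityMeasure_map ha.aemeasurable

theorem integral_stepLaw (ha : Measurable (Function.uncurry a)) (hac : ∀ g, Continuous (a g))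
    (ρ : Measure X) [IsProbabilityMeasure ρ] (f : C(X, ℝ)) :
    ∫ x, f x ∂(stepLaw μ a ρ) = ∫ x, markovOp μ ha hac f x ∂ρ := by
  unfold stepLaw
  rw [integral_map ha.aemeasurable f.continuous.measurable.aestronglyMeasurable, integral_prod_symm]
  · rfl
  · exact Integrable.of_bound (f.continuous.measurable.comp ha).aestronglyMeasurable ‖f‖
      (ae_of_all _ fun p => f.norm_coe_le_norm _)

theorem integral_stepLaw_iterate (ha : Measurable (Function.uncurry a))
    (hac : ∀ g, Continuous (a g)) (ρ : Measure X) [IsProbabilityMeasure ρ] (f : C(X, ℝ)) (k : ℕ) :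
    ∫ x, f x ∂((stepLaw μ a)^[k] ρ) = ∫ x, (markovOp μ ha hac ^ k) f x ∂ρ := by
  induction k generalizing f with
  | zero => rfl
  | succ k ih =>
    have := isProbabilityMeasure_stepLaw_iterate (μ := μ) ha (ρ := ρ) k
    rw [Function.iterate_succ_apply', integral_stepLaw ha hac, ih, pow_succ]
    rfl

/-- The average of the laws of the first `m` positions of the walk started at `x`. -/
noncomputable def occupationLaw (μ : Measure G) (a : G → X → X) (m : ℕ) (x : X) : Measure X :=
  (m : ℝ≥0∞)⁻¹ • ∑ k ∈ Finset.range m, (stepLaw μ a)^[k] (Measure.dirac x)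

omit [TopologicalSpace X] [CompactSpace X] [BorelSpace X] [SecondCountableTopology X] in
theorem isProbabilityMeasure_occupationLaw (ha : Measurable (Function.uncurry a)) {m : ℕ}
    (hm : m ≠ 0) (x : X) : IsProbabilityMeasure (occupationLaw μ a m x) := by
  constructor
  have h (k : ℕ) : (stepLaw μ a)^[k] (Measure.dirac x) Set.univ = 1 :=
    (isProbabilityMeasure_stepLaw_iterate ha k).measure_univ
  simp only [occupationLaw, Measure.smul_apply, Measure.finsetSum_apply, h, Finset.sum_const,
    Finset.card_range, nsmul_eq_mul, mul_one, smul_eq_mul]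
  exact ENNReal.inv_mul_cancel (by exact_mod_cast hm) (ENNReal.natCast_ne_top m)

variable [T2Space X]

theorem integral_occupationLaw (ha : Measurable (Function.uncurry a)) (hac : ∀ g, Continuous (a g))
    (m : ℕ) (x : X) (f : C(X, ℝ)) :
    ∫ y, f y ∂(occupationLaw μ a m x) =
      (m : ℝ)⁻¹ * ∑ k ∈ Finset.range m, (markovOp μ ha hac ^ k) f x := by
  have hp (k : ℕ) := isProbabilityMeasure_stepLaw_iterate (μ := μ) ha (ρ := Measure.dirac x) k
  rw [occupationLaw, integral_smul_measure,
    integral_finsetSum_measure fun k _ => integrable_continuousMap _ f]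
  simp only [integral_stepLaw_iterate ha hac, integral_dirac, smul_eq_mul, ENNReal.toReal_inv,
    ENNReal.toReal_natCast]

/-- If the stationary measure `ν` is unique, the averages `(1/m) ∑_{k < m} P^k ψ` come uniformly
close to `∫ ψ dν`. Otherwise the occupation laws from a sequence of bad starting points would
accumulate, by compactness, at another stationary measure. -/
theorem exists_average_markovOp_close (ha : Measurable (Function.uncurry a))
    (hac : ∀ g, Continuous (a g)) {ν : Measure X}
    (huniq : ∀ ν' : Measure X, IsProbabilityMeasure ν' →
      (∀ h : C(X, ℝ), ∫ x, ∫ g, h (a g x) ∂μ ∂ν' = ∫ x, h x ∂ν') → ν' = ν)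
    (ψ : C(X, ℝ)) {ε : ℝ} (hε : 0 < ε) :
    ∃ m : ℕ, m ≠ 0 ∧ ∀ x,
      |(m : ℝ)⁻¹ * ∑ k ∈ Finset.range m, (markovOp μ ha hac ^ k) ψ x - ∫ y, ψ y ∂ν| ≤ ε := by
  by_contra! hcon
  choose x hx using fun m : ℕ => hcon (m + 1) m.succ_ne_zero
  let ρ (m : ℕ) : ProbabilityMeasure X :=
    ⟨occupationLaw μ a (m + 1) (x m), isProbabilityMeasure_occupationLaw ha m.succ_ne_zero _⟩
  have hρ (f : C(X, ℝ)) (m : ℕ) : ∫ y, f y ∂(ρ m : Measure X) =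
      ((m + 1 : ℕ) : ℝ)⁻¹ * ∑ k ∈ Finset.range (m + 1), (markovOp μ ha hac ^ k) f (x m) :=
    integral_occupationLaw ha hac (m + 1) (x m) f
  obtain ⟨ν', -, hν'⟩ := isCompact_univ.ultrafilter_le_nhds ((hyperfilter ℕ).map ρ) (by simp)
  have hlim (f : C(X, ℝ)) : Tendsto (fun m => ∫ y, f y ∂(ρ m : Measure X))
      (hyperfilter ℕ : Filter ℕ) (𝓝 (∫ y, f y ∂(ν' : Measure X))) :=
    ProbabilityMeasure.tendsto_iff_forall_integral_tendsto.1
      (show Tendsto ρ (hyperfilter ℕ : Filter ℕ) (𝓝 ν') from hν')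
      (BoundedContinuousFunction.mkOfCompact f)
  -- `P` is a contraction, so replacing `f` by `P f` changes its average by at most `2 ‖f‖ / m`.
  have hpow_le (f : C(X, ℝ)) (k : ℕ) (y : X) : |(markovOp μ ha hac ^ k) f y| ≤ ‖f‖ := by
    have := isProbabilityMeasure_stepLaw_iterate (μ := μ) ha (ρ := Measure.dirac y) k
    have h := integral_stepLaw_iterate (μ := μ) ha hac (Measure.dirac y) f k
    rw [integral_dirac] at h
    rw [← h, ← Real.norm_eq_abs]
    refine (norm_integral_le_of_norm_le_const (ae_of_all _ fun z => f.norm_coe_le_norm z)).trans ?_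
    simp
  have hstat (f : C(X, ℝ)) :
      ∫ y, markovOp μ ha hac f y ∂(ν' : Measure X) = ∫ y, f y ∂(ν' : Measure X) := by
    have hd := (hlim (markovOp μ ha hac f)).sub (hlim f)
    have h0 : Tendsto (fun m => ∫ y, markovOp μ ha hac f y ∂(ρ m : Measure X) -
        ∫ y, f y ∂(ρ m : Measure X)) (hyperfilter ℕ : Filter ℕ) (𝓝 0) := by
      refine squeeze_zero_norm (a := fun m : ℕ => (2 * ‖f‖) * (1 / ((m : ℝ) + 1))) (fun m => ?_)
        (Tendsto.mono_left ?_ Nat.hyperfilter_le_atTop)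
      · rw [hρ, hρ, ← mul_sub, ← Finset.sum_sub_distrib]
        have htel : ∑ k ∈ Finset.range (m + 1),
            ((markovOp μ ha hac ^ k) (markovOp μ ha hac f) (x m) - (markovOp μ ha hac ^ k) f (x m)) =
              (markovOp μ ha hac ^ (m + 1)) f (x m) - f (x m) := by
          simpa only [pow_succ, Module.End.mul_apply, pow_zero, Module.End.one_apply] using
            Finset.sum_range_sub (fun k => (markovOp μ ha hac ^ k) f (x m)) (m + 1)
        rw [htel, norm_mul, mul_comm, norm_inv, ← one_div]
        gcongr
        · refine (norm_sub_le _ _).trans ?_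
          rw [two_mul]
          exact add_le_add (hpow_le f _ _) (f.norm_coe_le_norm _)
        · simp [abs_of_nonneg (by positivity : (0 : ℝ) ≤ (m : ℝ) + 1)]
      · simpa using (tendsto_one_div_add_atTop_nhds_zero_nat (𝕜 := ℝ)).const_mul (2 * ‖f‖)
    exact sub_eq_zero.1 (tendsto_nhds_unique hd h0)
  have hνν' : (ν' : Measure X) = ν := huniq ν' ν'.2 hstat
  have hge : ε ≤ |∫ y, ψ y ∂(ν' : Measure X) - ∫ y, ψ y ∂ν| :=
    ge_of_tendsto ((hlim ψ).sub_const _).abs (Eventually.of_forall fun m => by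
      rw [hρ]; exact (hx m).le)
  rw [hνν', sub_self, abs_zero] at hge
  exact absurd hge (not_le.2 hε)

/-- If the stationary measure `ν` is unique, every continuous function is uniformly close to the
constant `∫ ψ dν` plus a coboundary `h - P h`. -/
theorem exists_coboundary_close (ha : Measurable (Function.uncurry a))
    (hac : ∀ g, Continuous (a g)) {ν : Measure X}
    (huniq : ∀ ν' : Measure X, IsProbabilityMeasure ν' →
      (∀ h : C(X, ℝ), ∫ x, ∫ g, h (a g x) ∂μ ∂ν' = ∫ x, h x ∂ν') → ν' = ν)
    (ψ : C(X, ℝ)) {ε : ℝ} (hε : 0 < ε) :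
    ∃ h : C(X, ℝ), ∀ x, |ψ x - ∫ y, ψ y ∂ν - (h x - ∫ g, h (a g x) ∂μ)| ≤ ε := by
  obtain ⟨m, hm, hclose⟩ := exists_average_markovOp_close ha hac huniq ψ hε
  set P := markovOp μ ha hac with hP
  -- `h - P h = ψ - (1/m) ∑_{j < m} P^j ψ` for this choice of `h`.
  let h : C(X, ℝ) := (m : ℝ)⁻¹ • ∑ j ∈ Finset.range m, ∑ i ∈ Finset.range j, (P ^ i) ψ
  have hcob : h - P h = ψ - (m : ℝ)⁻¹ • ∑ j ∈ Finset.range m, (P ^ j) ψ := by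
    have hj (j : ℕ) : ∑ i ∈ Finset.range j, (P ^ i) ψ - P (∑ i ∈ Finset.range j, (P ^ i) ψ) =
        ψ - (P ^ j) ψ := by
      rw [map_sum, ← Finset.sum_sub_distrib]
      have := Finset.sum_range_sub' (fun i => (P ^ i) ψ) j
      simp only [pow_succ', Module.End.mul_apply, pow_zero, Module.End.one_apply] at this
      exact this
    simp only [h, map_smul, map_sum P (fun j => ∑ i ∈ Finset.range j, (P ^ i) ψ), ← smul_sub,
      ← Finset.sum_sub_distrib, hj]
    rw [Finset.sum_sub_distrib, smul_sub, Finset.sum_const, Finset.card_range,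
      ← Nat.cast_smul_eq_nsmul ℝ, smul_smul, inv_mul_cancel₀ (by exact_mod_cast hm), one_smul]
  refine ⟨h, fun x => ?_⟩
  have hx : h x - ∫ g, h (a g x) ∂μ =
      ψ x - (m : ℝ)⁻¹ * ∑ j ∈ Finset.range m, (P ^ j) ψ x := by
    have := DFunLike.congr_fun hcob x
    simpa [hP, markovOp_apply] using this
  rw [hx]
  convert hclose x using 2
  ring

end Markov

/-! ### The law of large numbers for cocycles over a uniquely ergodic walk -/

section Iid

variable {G : Type*} [MeasurableSpace G] {μ : Measure G} [IsProbabilityMeasure μ]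

theorem integrable_and_integral_sum_infinitePi {R : G → ℝ} (hR : Integrable R μ) (n : ℕ) :
    Integrable (fun ω : ℕ → G => ∑ k ∈ Finset.range n, R (ω k))
        (Measure.infinitePi fun _ : ℕ => μ) ∧
      ∫ ω, ∑ k ∈ Finset.range n, R (ω k) ∂(Measure.infinitePi fun _ : ℕ => μ) =
        n * ∫ g, R g ∂μ := by
  have hi (k : ℕ) : Integrable (fun ω : ℕ → G => R (ω k)) (Measure.infinitePi fun _ : ℕ => μ) :=
    (measurePreserving_eval_infinitePi (fun _ : ℕ => μ) k).integrable_comp_of_integrable hR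
  have he (k : ℕ) : ∫ ω, R (ω k) ∂(Measure.infinitePi fun _ : ℕ => μ) = ∫ g, R g ∂μ := by
    have hp := measurePreserving_eval_infinitePi (fun _ : ℕ => μ) k
    have h := integral_map hp.aemeasurable (by rw [hp.map_eq]; exact hR.aestronglyMeasurable)
    rw [hp.map_eq] at h
    exact h.symm
  refine ⟨integrable_finsetSum _ fun k _ => hi k, ?_⟩
  rw [integral_finsetSum _ fun k _ => hi k]
  simp [he]

theorem ae_tendsto_sum_infinitePi_div {R : G → ℝ} (hRm : Measurable R) (hR : Integrable R μ) :
    ∀ᵐ ω ∂(Measure.infinitePi fun _ : ℕ => μ),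
      Tendsto (fun n : ℕ => (∑ k ∈ Finset.range n, R (ω k)) / n) atTop (𝓝 (∫ g, R g ∂μ)) := by
  have hp (k : ℕ) := measurePreserving_eval_infinitePi (fun _ : ℕ => μ) k
  have hid (k : ℕ) : ProbabilityTheory.IdentDistrib (fun ω : ℕ → G => R (ω k)) (fun ω => R (ω 0))
      (Measure.infinitePi fun _ : ℕ => μ) (Measure.infinitePi fun _ : ℕ => μ) := by
    refine ⟨(hRm.comp (measurable_pi_apply k)).aemeasurable,
      (hRm.comp (measurable_pi_apply 0)).aemeasurable, ?_⟩
    have hmap (j : ℕ) : Measure.map (fun ω : ℕ → G => R (ω j)) (Measure.infinitePi fun _ : ℕ => μ) =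
        μ.map R := by
      conv_rhs => rw [← (hp j).map_eq, Measure.map_map hRm (hp j).measurable]
      rfl
    rw [hmap, hmap]
  have h := ProbabilityTheory.strong_law_ae_real (fun k (ω : ℕ → G) => R (ω k))
    ((hp 0).integrable_comp_of_integrable hR)
    (fun i j hij => (ProbabilityTheory.iIndepFun_infinitePi (P := fun _ : ℕ => μ)
      (X := fun _ => R) fun _ => hRm).indepFun hij) hid
  have he := (integrable_and_integral_sum_infinitePi hR 1).2
  simp only [Finset.range_one, Finset.sum_singleton, Nat.cast_one, one_mul] at he
  rwa [he] at h

end Iid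

section Cocycle

variable {G X : Type*} [MeasurableSpace G] [TopologicalSpace X] [CompactSpace X] [T2Space X]
  [SecondCountableTopology X] [MeasurableSpace X] [BorelSpace X] {μ : Measure G}
  [IsProbabilityMeasure μ] {a : G → X → X} {σ : G → X → ℝ} {Z : G → ℝ}

omit [CompactSpace X] [T2Space X] [BorelSpace X] [IsProbabilityMeasure μ] in
theorem continuous_integral_of_dominated (hσ : Measurable (Function.uncurry σ))
    (hσc : ∀ g, Continuous (σ g)) (hZ : Integrable Z μ) (hσZ : ∀ g x, |σ g x| ≤ Z g) :
    Continuous fun x => ∫ g, σ g x ∂μ :=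
  continuous_of_dominated (fun _ => (hσ.comp measurable_prodMk_right).aestronglyMeasurable)
    (fun x => ae_of_all _ fun g => hσZ g x) hZ (ae_of_all _ hσc)

omit [TopologicalSpace X] [CompactSpace X] [T2Space X] [SecondCountableTopology X] [BorelSpace X]
  [IsProbabilityMeasure μ] in
theorem integrable_of_dominated (hσ : Measurable (Function.uncurry σ)) (hZ : Integrable Z μ)
    (hσZ : ∀ g x, |σ g x| ≤ Z g) (x : X) : Integrable (fun g => σ g x) μ :=
  hZ.mono' (hσ.comp measurable_prodMk_right).aestronglyMeasurable (ae_of_all _ fun g => hσZ g x)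

omit [IsProbabilityMeasure μ] in
/-- Integrable functions have small integral over their high superlevel sets. -/
theorem exists_integral_tail_le (hZm : Measurable Z) (hZ : Integrable Z μ) {ε : ℝ} (hε : 0 < ε) :
    ∃ M : ℕ, ∫ g, (if Z g ≤ M then 0 else Z g) ∂μ ≤ ε := by
  have h : Tendsto (fun M : ℕ => ∫ g, (if Z g ≤ M then 0 else Z g) ∂μ) atTop (𝓝 (∫ _, 0 ∂μ)) := by
    refine tendsto_integral_of_dominated_convergence (fun g => |Z g|) (fun M => ?_) hZ.abs
      (fun M => ae_of_all _ fun g => ?_) (ae_of_all _ fun g => ?_)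
    · exact (Measurable.ite (measurableSet_le hZm measurable_const) measurable_const
        hZm).aestronglyMeasurable
    · split_ifs <;> simp
    · refine tendsto_const_nhds.congr' ?_
      filter_upwards [eventually_ge_atTop ⌈Z g⌉₊] with M hM
      rw [if_pos ((Nat.le_ceil _).trans (by exact_mod_cast hM))]
  rw [integral_zero] at h
  obtain ⟨M, hM⟩ := (h.eventually_lt_const hε).exists
  exact ⟨M, hM.le⟩

/-- Up to an error of mean at most `ε` per step and a bounded error, the centred cocycle sum over
the walk is a sum of bounded martingale differences: the cocycle is truncated where its bound `Z` is
large, and its conditional mean is replaced by a coboundary. -/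
theorem exists_walkSum_approx (ha : Measurable (Function.uncurry a)) (hac : ∀ g, Continuous (a g))
    {ν : Measure X} [IsProbabilityMeasure ν]
    (huniq : ∀ ν' : Measure X, IsProbabilityMeasure ν' →
      (∀ h : C(X, ℝ), ∫ x, ∫ g, h (a g x) ∂μ ∂ν' = ∫ x, h x ∂ν') → ν' = ν)
    (hσ : Measurable (Function.uncurry σ)) (hσc : ∀ g, Continuous (σ g))
    (hZm : Measurable Z) (hZ : Integrable Z μ) (hσZ : ∀ g x, |σ g x| ≤ Z g) {ε : ℝ} (hε : 0 < ε) :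
    ∃ (τ : G → X → ℝ) (C : ℝ) (R : G → ℝ) (K : ℝ), Measurable (Function.uncurry τ) ∧
      (∀ g x, |τ g x| ≤ C) ∧ (∀ x, ∫ g, τ g x ∂μ = 0) ∧ Measurable R ∧ Integrable R μ ∧
      ∫ g, R g ∂μ ≤ ε ∧
      ∀ ω x n, |walkSum a σ ω x n - n * ∫ y, ∫ g, σ g y ∂μ ∂ν| ≤
        |walkSum a τ ω x n| + ∑ k ∈ Finset.range n, R (ω k) + K + n * ε := by
  obtain ⟨M, hM⟩ := exists_integral_tail_le hZm hZ (half_pos hε)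
  -- A point of `X` is needed only for `0 ≤ Z`.
  obtain ⟨x₀⟩ : Nonempty X := ν.nonempty_of_neZero
  have hZ0 (g : G) : 0 ≤ Z g := (abs_nonneg _).trans (hσZ g x₀)
  set R : G → ℝ := fun g => if Z g ≤ M then 0 else Z g with hR
  have hRm : Measurable R :=
    Measurable.ite (measurableSet_le hZm measurable_const) measurable_const hZm
  have hR0 (g : G) : 0 ≤ R g := by
    simp only [hR]; split_ifs <;> simp [hZ0]
  have hRi : Integrable R μ := hZ.mono' hRm.aestronglyMeasurable (ae_of_all _ fun g => by
    rw [Real.norm_eq_abs, abs_of_nonneg (hR0 g)]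
    simp only [hR]; split_ifs <;> simp [hZ0])
  -- `s` is the cocycle truncated to `Z ≤ M`, and `R` bounds what the truncation removes.
  let s : G → X → ℝ := fun g x => if Z g ≤ M then σ g x else 0
  have hs : Measurable (Function.uncurry s) :=
    Measurable.ite (measurableSet_le (hZm.comp measurable_fst) measurable_const) hσ measurable_const
  have hsM (g : G) (x : X) : |s g x| ≤ M := by
    simp only [s]; split_ifs with h
    · exact (hσZ g x).trans h
    · simp
  have hsR (g : G) (x : X) : |σ g x - s g x| ≤ R g := by
    simp only [s, hR]; split_ifs with h
    · simp
    · simpa using hσZ g x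
  have hsc (g : G) : Continuous (s g) := by
    by_cases h : Z g ≤ M
    · simpa [s, h] using hσc g
    · simpa [s, h] using continuous_const
  have hMi : Integrable (fun _ : G => (M : ℝ)) μ := integrable_const _
  let ψ : C(X, ℝ) := ⟨fun x => ∫ g, s g x ∂μ, continuous_integral_of_dominated hs hsc hMi hsM⟩
  let ψ' : C(X, ℝ) := ⟨fun x => ∫ g, σ g x ∂μ, continuous_integral_of_dominated hσ hσc hZ hσZ⟩
  have hsi (x : X) : Integrable (fun g => s g x) μ := integrable_of_dominated hs hMi hsM x
  have hψM (x : X) : |ψ x| ≤ M := by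
    change |∫ g, s g x ∂μ| ≤ M
    simpa using norm_integral_le_of_norm_le_const (μ := μ) (f := fun g => s g x) (C := M)
      (ae_of_all _ fun g => hsM g x)
  have hmean : |∫ y, ψ y ∂ν - ∫ y, ψ' y ∂ν| ≤ ε / 2 := by
    rw [← integral_sub (integrable_continuousMap ν ψ) (integrable_continuousMap ν ψ')]
    have hpt (y : X) : ‖ψ y - ψ' y‖ ≤ ε / 2 := by
      change ‖∫ g, s g y ∂μ - ∫ g, σ g y ∂μ‖ ≤ ε / 2
      rw [← integral_sub (hsi y) (integrable_of_dominated hσ hZ hσZ y)]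
      refine (norm_integral_le_of_norm_le hRi (ae_of_all _ fun g => ?_)).trans hM
      rw [norm_sub_rev]
      exact hsR g y
    simpa using norm_integral_le_of_norm_le_const (μ := ν) (ae_of_all _ hpt)
  obtain ⟨h, hh⟩ := exists_coboundary_close ha hac huniq ψ (half_pos hε)
  let Ph : C(X, ℝ) := markovOp μ ha hac h
  have hPh (x : X) : |Ph x| ≤ ‖h‖ := by
    change |∫ g, h (a g x) ∂μ| ≤ ‖h‖
    simpa using norm_integral_le_of_norm_le_const (μ := μ) (f := fun g => h (a g x)) (C := ‖h‖)
      (ae_of_all _ fun g => h.norm_coe_le_norm _)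
  have hhn (x : X) : |h x| ≤ ‖h‖ := h.norm_coe_le_norm x
  let τ : G → X → ℝ := fun g x => (s g x - ψ x) + (h (a g x) - Ph x)
  refine ⟨τ, 2 * M + 2 * ‖h‖, R, 2 * ‖h‖, ?_, fun g x => ?_, fun x => ?_, hRm, hRi,
    hM.trans (half_le_self hε.le), fun ω x n => ?_⟩
  · exact (hs.sub (ψ.continuous.measurable.comp measurable_snd)).add
      ((h.continuous.measurable.comp ha).sub (Ph.continuous.measurable.comp measurable_snd))
  · have h1 := abs_le.mp (hsM g x)
    have h2 := abs_le.mp (hψM x)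
    have h3 := abs_le.mp (hhn (a g x))
    have h4 := abs_le.mp (hPh x)
    exact abs_le.mpr ⟨by simp only [τ]; linarith, by simp only [τ]; linarith⟩
  · have hhi := integrable_continuousMap_comp μ ha h x
    have hi1 : Integrable (fun g => s g x - ψ x) μ := (hsi x).sub (integrable_const _)
    have hi2 : Integrable (fun g => h (a g x) - Ph x) μ := hhi.sub (integrable_const _)
    change ∫ g, ((s g x - ψ x) + (h (a g x) - Ph x)) ∂μ = 0
    rw [integral_add hi1 hi2, integral_sub (hsi x) (integrable_const _),
      integral_sub hhi (integrable_const _)]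
    simp [ψ, Ph, markovOp_apply]
  · set lam := ∫ y, ∫ g, σ g y ∂μ ∂ν with hlam
    have hstep (g : G) (y : X) : |σ g y - lam - τ g y - (h y - h (a g y))| ≤ R g + ε := by
      have h1 := abs_le.mp (hsR g y)
      have h2 := abs_le.mp hmean
      have h3 := abs_le.mp (hh y)
      change _ ≤ ψ y - ∫ y, ψ y ∂ν - (h y - Ph y) ∧ ψ y - ∫ y, ψ y ∂ν - (h y - Ph y) ≤ _ at h3
      change _ ≤ ∫ y, ψ y ∂ν - lam ∧ ∫ y, ψ y ∂ν - lam ≤ _ at h2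
      exact abs_le.mpr ⟨by simp only [τ]; linarith, by simp only [τ]; linarith⟩
    have hsum : walkSum a σ ω x n - n * lam = walkSum a τ ω x n + (h x - h (walk a ω x n)) +
        ∑ k ∈ Finset.range n, (σ (ω k) (walk a ω x k) - lam - τ (ω k) (walk a ω x k) -
          (h (walk a ω x k) - h (a (ω k) (walk a ω x k)))) := by
      have htel := Finset.sum_range_sub' (fun k => h (walk a ω x k)) n
      simp only [walk] at htel
      simp only [Finset.sum_sub_distrib] at htel ⊢
      simp only [walkSum, Finset.sum_const, Finset.card_range, nsmul_eq_mul]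
      linarith
    have herr := (Finset.abs_sum_le_sum_abs (fun k => σ (ω k) (walk a ω x k) - lam -
      τ (ω k) (walk a ω x k) - (h (walk a ω x k) - h (a (ω k) (walk a ω x k))))
      (Finset.range n)).trans (Finset.sum_le_sum fun k _ => hstep (ω k) (walk a ω x k))
    rw [Finset.sum_add_distrib, Finset.sum_const, Finset.card_range, nsmul_eq_mul] at herr
    rw [hsum]
    have h1 := hhn x
    have h2 := hhn (walk a ω x n)
    refine (abs_add_three _ _ _).trans ?_
    have h3 := abs_sub (h x) (h (walk a ω x n))
    linarith

variable (ha : Measurable (Function.uncurry a)) (hac : ∀ g, Continuous (a g))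
  {ν : Measure X} [IsProbabilityMeasure ν]
  (huniq : ∀ ν' : Measure X, IsProbabilityMeasure ν' →
    (∀ h : C(X, ℝ), ∫ x, ∫ g, h (a g x) ∂μ ∂ν' = ∫ x, h x ∂ν') → ν' = ν)
  (hσ : Measurable (Function.uncurry σ)) (hσc : ∀ g, Continuous (σ g))
  (hZm : Measurable Z) (hZ : Integrable Z μ) (hσZ : ∀ g x, |σ g x| ≤ Z g)

include ha hac huniq hσ hσc hZm hZ hσZ

/-- The pointwise law of large numbers: over a walk with a unique stationary measure, the
averages of a dominated cocycle converge almost surely, from every starting point. -/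
theorem ae_tendsto_walkSum_div_of_unique (x : X) :
    ∀ᵐ ω ∂(Measure.infinitePi fun _ : ℕ => μ),
      Tendsto (fun n : ℕ => walkSum a σ ω x n / n) atTop (𝓝 (∫ y, ∫ g, σ g y ∂μ ∂ν)) := by
  have hae (j : ℕ) : ∀ᵐ ω ∂(Measure.infinitePi fun _ : ℕ => μ), ∀ᶠ n : ℕ in atTop,
      |walkSum a σ ω x n / n - ∫ y, ∫ g, σ g y ∂μ ∂ν| < 3 * (1 / ((j : ℝ) + 1)) := by
    have hε : (0 : ℝ) < 1 / ((j : ℝ) + 1) := by positivity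
    obtain ⟨τ, C, R, K, hτ, hC, hmean, hRm, hRi, hRε, hbound⟩ :=
      exists_walkSum_approx ha hac huniq hσ hσc hZm hZ hσZ hε
    filter_upwards [ae_tendsto_walkSum_div (μ := μ) ha hτ hC hmean x,
      ae_tendsto_sum_infinitePi_div hRm hRi] with ω h1 h2
    have hlim := ((h1.abs.add h2).add (tendsto_const_div_atTop_nhds_zero_nat K)).add_const
      (1 / ((j : ℝ) + 1))
    filter_upwards [hlim.eventually_lt_const (u := 3 * (1 / ((j : ℝ) + 1)))
      (by rw [abs_zero]; linarith), eventually_ge_atTop 1] with n hn hn1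
    have hn0 : (0 : ℝ) < n := by positivity
    refine lt_of_le_of_lt ?_ hn
    have hb := hbound ω x n
    have e1 : walkSum a σ ω x n / n - ∫ y, ∫ g, σ g y ∂μ ∂ν =
        (walkSum a σ ω x n - n * ∫ y, ∫ g, σ g y ∂μ ∂ν) / n := by field_simp
    rw [e1, abs_div, abs_div, abs_of_pos hn0, ← add_div, ← add_div, div_le_iff₀ hn0, add_mul,
      div_mul_cancel₀ _ hn0.ne']
    linarith
  filter_upwards [ae_all_iff.2 hae] with ω hω
  rw [Metric.tendsto_atTop']
  intro ε hε
  obtain ⟨j, hj⟩ := exists_nat_one_div_lt (show 0 < ε / 3 by positivity)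
  obtain ⟨N, hN⟩ := eventually_atTop.1 (hω j)
  refine ⟨N, fun n hn => ?_⟩
  rw [Real.dist_eq]
  linarith [hN n hn.le]

/-- The averages converge in mean, uniformly in the starting point. -/
theorem exists_lintegral_walkSum_div_le {ε : ℝ} (hε : 0 < ε) :
    ∃ N : ℕ, ∀ n ≥ N, ∀ x, ∫⁻ ω, ‖walkSum a σ ω x n / n - ∫ y, ∫ g, σ g y ∂μ ∂ν‖ₑ
      ∂(Measure.infinitePi fun _ : ℕ => μ) ≤ ENNReal.ofReal ε := by
  set δ := ε / 4 with hδ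
  have hδ0 : 0 < δ := by positivity
  obtain ⟨τ, C, R, K, hτ, hC, hmean, hRm, hRi, hRε, hbound⟩ :=
    exists_walkSum_approx ha hac huniq hσ hσc hZm hZ hσZ hδ0
  have hlim := (tendsto_const_div_atTop_nhds_zero_nat (C ^ 2 / (2 * δ))).add
    (tendsto_const_div_atTop_nhds_zero_nat K)
  rw [add_zero] at hlim
  obtain ⟨N, hN⟩ := eventually_atTop.1 (hlim.eventually_lt_const hδ0)
  refine ⟨max N 1, fun n hn x => ?_⟩
  have hn0 : (0 : ℝ) < n := by
    have : 1 ≤ n := (le_max_right _ _).trans hn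
    positivity
  have hNn := hN n ((le_max_left _ _).trans hn)
  set P := Measure.infinitePi fun _ : ℕ => μ with hP
  obtain ⟨hRsi, hRse⟩ := integrable_and_integral_sum_infinitePi hRi n
  have hsq := integrable_walkSum_pow (μ := μ) ha hτ hC x n 2
  have hpt (ω : ℕ → G) : |walkSum a σ ω x n / n - ∫ y, ∫ g, σ g y ∂μ ∂ν| ≤
      walkSum a τ ω x n ^ 2 * (1 / (2 * δ * n ^ 2)) + (∑ k ∈ Finset.range n, R (ω k)) * (1 / n) +
        (δ / 2 + K / n + δ) := by
    have hb := hbound ω x n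
    have e1 : walkSum a σ ω x n / n - ∫ y, ∫ g, σ g y ∂μ ∂ν =
        (walkSum a σ ω x n - n * ∫ y, ∫ g, σ g y ∂μ ∂ν) / n := by field_simp
    -- `|t| ≤ t² / (2δn) + δn/2` turns the second moment bound into a first moment bound.
    have h2 : |walkSum a τ ω x n| ≤ walkSum a τ ω x n ^ 2 / (2 * δ * n) + δ * n / 2 := by
      have h0 : 0 ≤ (|walkSum a τ ω x n| - δ * n) ^ 2 / (2 * δ * n) := by positivity
      have e : (|walkSum a τ ω x n| - δ * n) ^ 2 / (2 * δ * n) =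
          walkSum a τ ω x n ^ 2 / (2 * δ * n) + δ * n / 2 - |walkSum a τ ω x n| := by
        rw [sub_sq, sq_abs]
        field_simp
        ring
      linarith
    rw [e1, abs_div, abs_of_pos hn0, div_le_iff₀ hn0]
    refine hb.trans ?_
    have e2 : (walkSum a τ ω x n ^ 2 * (1 / (2 * δ * n ^ 2)) +
        (∑ k ∈ Finset.range n, R (ω k)) * (1 / n) + (δ / 2 + K / n + δ)) * n =
        walkSum a τ ω x n ^ 2 / (2 * δ * n) + δ * n / 2 + ∑ k ∈ Finset.range n, R (ω k) + K +
          n * δ := by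
      field_simp
      ring
    rw [e2]
    linarith
  have hi1 := (hsq.mul_const (1 / (2 * δ * n ^ 2))).add (hRsi.mul_const (1 / (n : ℝ)))
  have hi := hi1.add (integrable_const (δ / 2 + K / n + δ))
  calc ∫⁻ ω, ‖walkSum a σ ω x n / n - ∫ y, ∫ g, σ g y ∂μ ∂ν‖ₑ ∂P
      ≤ ∫⁻ ω, ENNReal.ofReal (walkSum a τ ω x n ^ 2 * (1 / (2 * δ * n ^ 2)) +
          (∑ k ∈ Finset.range n, R (ω k)) * (1 / n) + (δ / 2 + K / n + δ)) ∂P :=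
        lintegral_mono fun ω => by
          rw [Real.enorm_eq_ofReal_abs]
          exact ENNReal.ofReal_le_ofReal (hpt ω)
    _ = ENNReal.ofReal (∫ ω, (walkSum a τ ω x n ^ 2 * (1 / (2 * δ * n ^ 2)) +
          (∑ k ∈ Finset.range n, R (ω k)) * (1 / n) + (δ / 2 + K / n + δ)) ∂P) :=
        (ofReal_integral_eq_lintegral_ofReal hi
          (ae_of_all _ fun ω => (abs_nonneg _).trans (hpt ω))).symm
    _ ≤ ENNReal.ofReal ε := by
        refine ENNReal.ofReal_le_ofReal ?_
        have e1 := integral_add hi1 (integrable_const (δ / 2 + K / n + δ))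
        have e2 := integral_add (hsq.mul_const (1 / (2 * δ * n ^ 2)))
          (hRsi.mul_const (1 / (n : ℝ)))
        simp only [Pi.add_apply] at e1 e2
        rw [e1, e2, integral_mul_const, integral_mul_const, hRse, integral_const, probReal_univ,
          one_smul]
        have hv := mul_le_mul_of_nonneg_right
          (integral_walkSum_sq_le (μ := μ) ha hτ hC hmean n x)
          (show 0 ≤ 1 / (2 * δ * (n : ℝ) ^ 2) by positivity)
        have ev : n * C ^ 2 * (1 / (2 * δ * (n : ℝ) ^ 2)) = C ^ 2 / (2 * δ) / n := by
          field_simp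
        have er : n * (∫ g, R g ∂μ) * (1 / (n : ℝ)) = ∫ g, R g ∂μ := by
          field_simp
        rw [er]
        rw [ev] at hv
        linarith

end Cocycle

/-! ### The space of directions as a sphere -/

section Direction

variable {d : ℕ}

/-- The direction of a unit vector. -/
def Dir.ofSphere (u : Metric.sphere (0 : Euc d) 1) : Dir d :=
  Quotient.mk (dirSetoid d) ⟨u, ne_zero_of_mem_unit_sphere u⟩

/-- The unit vector pointing in a given direction. -/
noncomputable def Dir.toSphere : Dir d → Metric.sphere (0 : Euc d) 1 :=
  Quotient.lift (fun x : {x : Euc d // x ≠ 0} =>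
    (⟨‖(x : Euc d)‖⁻¹ • (x : Euc d), by
      simp [norm_smul, norm_ne_zero_iff.mpr x.2]⟩ : Metric.sphere (0 : Euc d) 1)) (by
    rintro x y ⟨r, hr, h⟩
    have hr' : ‖r • (y : Euc d)‖⁻¹ • r • (y : Euc d) = ‖(y : Euc d)‖⁻¹ • (y : Euc d) := by
      rw [norm_smul, Real.norm_of_nonneg hr.le, smul_smul, mul_inv, mul_right_comm,
        inv_mul_cancel₀ hr.ne', one_mul]
    exact Subtype.ext (by simp only [h, hr']))

theorem Dir.ofSphere_toSphere (x : Dir d) : Dir.ofSphere (Dir.toSphere x) = x := by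
  induction x using Quotient.inductionOn with
  | h x => exact Quotient.sound ⟨‖(x : Euc d)‖⁻¹, inv_pos.mpr (norm_pos_iff.mpr x.2), rfl⟩

theorem Dir.toSphere_ofSphere (u : Metric.sphere (0 : Euc d) 1) :
    Dir.toSphere (Dir.ofSphere u) = u := by
  refine Subtype.ext ?_
  change ‖(u : Euc d)‖⁻¹ • (u : Euc d) = u
  rw [norm_eq_of_mem_sphere u, inv_one, one_smul]

/-- The space of directions is homeomorphic to the unit sphere. -/
noncomputable def Dir.homeoSphere : Dir d ≃ₜ Metric.sphere (0 : Euc d) 1 where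
  toFun := Dir.toSphere
  invFun := Dir.ofSphere
  left_inv := Dir.ofSphere_toSphere
  right_inv := Dir.toSphere_ofSphere
  continuous_toFun := by
    refine Continuous.quotient_lift (Continuous.subtype_mk ?_ _) _
    exact (continuous_subtype_val.norm.inv₀ fun x => norm_ne_zero_iff.mpr x.2).smul
      continuous_subtype_val
  continuous_invFun := continuous_quotient_mk'.comp (continuous_subtype_val.subtype_mk _)

instance : CompactSpace (Dir d) := Dir.homeoSphere.symm.compactSpace

instance : T2Space (Dir d) := Dir.homeoSphere.symm.t2Space

instance : SecondCountableTopology (Dir d) := Dir.homeoSphere.secondCountableTopology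

theorem PosHom.continuous_onSphere : Continuous (PosHom.onSphere (d := d)) :=
  continuous_induced_dom

/-- Evaluation at the unit representative of a direction is jointly continuous. -/
theorem PosHom.continuous_apply_toSphere :
    Continuous fun p : PosHom d × Dir d => p.1.toFun (Dir.toSphere p.2 : Euc d) := by
  have h : Continuous fun p : C(Metric.sphere (0 : Euc d) 1, Euc d) × Metric.sphere (0 : Euc d) 1 =>
      p.1 p.2 := ContinuousEval.continuous_eval
  exact h.comp ((PosHom.continuous_onSphere.comp continuous_fst).prodMk
    (Dir.homeoSphere.continuous.comp continuous_snd))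

theorem PosHom.apply_toSphere_ne_zero (f : PosHom d) (x : Dir d) :
    f.toFun (Dir.toSphere x : Euc d) ≠ 0 :=
  f.ne_zero _ (ne_zero_of_mem_unit_sphere _)

theorem PosHom.act_eq (f : PosHom d) (x : Dir d) :
    f.act x = Quotient.mk (dirSetoid d) ⟨_, f.apply_toSphere_ne_zero x⟩ := by
  conv_lhs => rw [← Dir.ofSphere_toSphere x]
  rfl

theorem PosHom.cocycle_eq (f : PosHom d) (x : Dir d) :
    f.cocycle x = Real.log ‖f.toFun (Dir.toSphere x : Euc d)‖ := by
  conv_lhs => rw [← Dir.ofSphere_toSphere x]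
  change Real.log (‖f.toFun (Dir.toSphere x : Euc d)‖ / ‖(Dir.toSphere x : Euc d)‖) = _
  rw [norm_eq_of_mem_sphere, div_one]

theorem PosHom.continuous_act : Continuous fun p : PosHom d × Dir d => p.1.act p.2 := by
  simp only [PosHom.act_eq]
  exact continuous_quotient_mk'.comp (PosHom.continuous_apply_toSphere.subtype_mk _)

theorem PosHom.continuous_cocycle : Continuous fun p : PosHom d × Dir d => p.1.cocycle p.2 := by
  simp only [PosHom.cocycle_eq]
  exact PosHom.continuous_apply_toSphere.norm.log fun p =>
    norm_ne_zero_iff.mpr (p.1.apply_toSphere_ne_zero p.2)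

theorem PosHom.continuous_act_right (f : PosHom d) : Continuous f.act :=
  PosHom.continuous_act.comp (Continuous.prodMk_right f)

theorem PosHom.continuous_cocycle_right (f : PosHom d) : Continuous f.cocycle := by
  have h : f.cocycle = (fun p : PosHom d × Dir d => p.1.cocycle p.2) ∘ fun x => (f, x) :=
    funext fun _ => rfl
  rw [h]
  exact PosHom.continuous_cocycle.comp (Continuous.prodMk_right f)

theorem PosHom.measurable_iSup_enorm_cocycle :
    Measurable fun f : PosHom d => ⨆ x : Dir d, ‖f.cocycle x‖ₑ :=
  LowerSemicontinuous.measurable <| lowerSemicontinuous_iSup fun _ =>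
    (PosHom.continuous_cocycle.comp
      (continuous_id.prodMk continuous_const)).enorm.lowerSemicontinuous

theorem PosHom.iSup_enorm_cocycle_lt_top (f : PosHom d) : ⨆ x : Dir d, ‖f.cocycle x‖ₑ < ∞ := by
  let h : C(Dir d, ℝ) := ⟨f.cocycle, f.continuous_cocycle_right⟩
  refine lt_of_le_of_lt (b := ENNReal.ofReal ‖h‖) (iSup_le fun x => ?_) ENNReal.ofReal_lt_top
  rw [Real.enorm_eq_ofReal_abs]
  exact ENNReal.ofReal_le_ofReal (h.norm_coe_le_norm x)

end Direction

/-! ### Random products of positively homogeneous maps -/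

section RandomProduct

variable {d : ℕ} {G : Type*}

theorem orbit_ne_zero (F : G → PosHom d) (ω : ℕ → G) {x₀ : Euc d} (hx₀ : x₀ ≠ 0) (ℓ : ℕ) :
    orbit F ω x₀ ℓ ≠ 0 := by
  induction ℓ with
  | zero => exact hx₀
  | succ ℓ ih => exact (F (ω ℓ)).ne_zero _ ih

theorem mk_orbit (F : G → PosHom d) (ω : ℕ → G) {x₀ : Euc d} (hx₀ : x₀ ≠ 0) (ℓ : ℕ) :
    (Quotient.mk (dirSetoid d) ⟨orbit F ω x₀ ℓ, orbit_ne_zero F ω hx₀ ℓ⟩ : Dir d) =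
      walk (fun g => (F g).act) ω (Quotient.mk (dirSetoid d) ⟨x₀, hx₀⟩) ℓ := by
  induction ℓ with
  | zero => rfl
  | succ ℓ ih =>
    change _ = (F (ω ℓ)).act (walk (fun g => (F g).act) ω _ ℓ)
    rw [← ih]
    rfl

/-- The logarithmic growth of an orbit is the cocycle summed along the walk of its direction. -/
theorem log_norm_orbit_sub (F : G → PosHom d) (ω : ℕ → G) {x₀ : Euc d} (hx₀ : x₀ ≠ 0) (ℓ : ℕ) :
    Real.log ‖orbit F ω x₀ ℓ‖ - Real.log ‖x₀‖ =
      walkSum (fun g => (F g).act) (fun g => (F g).cocycle) ω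
        (Quotient.mk (dirSetoid d) ⟨x₀, hx₀⟩) ℓ := by
  induction ℓ with
  | zero => simp [orbit, walkSum]
  | succ ℓ ih =>
    simp only [walkSum, Finset.sum_range_succ] at ih ⊢
    rw [← ih, ← mk_orbit F ω hx₀]
    change _ = _ + Real.log (‖orbit F ω x₀ (ℓ + 1)‖ / ‖orbit F ω x₀ ℓ‖)
    rw [Real.log_div (norm_ne_zero_iff.mpr (orbit_ne_zero F ω hx₀ _))
      (norm_ne_zero_iff.mpr (orbit_ne_zero F ω hx₀ _))]
    ring

variable [MeasurableSpace G]

/-- The law of large numbers for the norm of a random product of positively homogeneous maps that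
are indexed measurably by an i.i.d. parameter. -/
theorem lln_of_measurable_family {F : G → PosHom d} (hF : Measurable F) (μ : Measure G)
    [IsProbabilityMeasure μ]
    (huniq : ∃! ν : Measure (Dir d), IsProbabilityMeasure ν ∧ IsSphericalStationary F μ ν)
    (hmom : ∫⁻ g, ⨆ x : Dir d, ‖(F g).cocycle x‖ₑ ∂μ < ∞) :
    ∃ lam : ℝ,
      (∀ x₀ : Euc d, x₀ ≠ 0 →
        ∀ᵐ ω ∂(Measure.infinitePi fun _ : ℕ => μ),
          Tendsto (fun ℓ : ℕ => 1 / (ℓ : ℝ) * Real.log ‖orbit F ω x₀ ℓ‖) atTop (𝓝 lam)) ∧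
      Tendsto (fun ℓ : ℕ => ⨆ x₀ : {x : Euc d // x ≠ 0},
          ∫⁻ ω, ‖1 / (ℓ : ℝ) *
              (Real.log ‖orbit F ω (x₀ : Euc d) ℓ‖ - Real.log ‖(x₀ : Euc d)‖) - lam‖ₑ
            ∂(Measure.infinitePi fun _ : ℕ => μ))
        atTop (𝓝 0) ∧
      ∀ ν : Measure (Dir d), IsProbabilityMeasure ν → IsSphericalStationary F μ ν →
        Integrable (fun p : G × Dir d => (F p.1).cocycle p.2) (μ.prod ν) ∧
        lam = ∫ p : G × Dir d, (F p.1).cocycle p.2 ∂(μ.prod ν) := by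
  obtain ⟨ν, ⟨hνp, -⟩, hν⟩ := huniq
  let a : G → Dir d → Dir d := fun g => (F g).act
  let σ : G → Dir d → ℝ := fun g => (F g).cocycle
  let Z : G → ℝ := fun g => (⨆ x : Dir d, ‖(F g).cocycle x‖ₑ).toReal
  have hpair : Measurable fun p : G × Dir d => (F p.1, p.2) :=
    (hF.comp measurable_fst).prodMk measurable_snd
  have ha : Measurable (Function.uncurry a) := PosHom.continuous_act.measurable.comp hpair
  have hσ : Measurable (Function.uncurry σ) := by
    have h : Function.uncurry σ =
        (fun p : PosHom d × Dir d => p.1.cocycle p.2) ∘ fun p : G × Dir d => (F p.1, p.2) :=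
      funext fun _ => rfl
    rw [h]
    exact PosHom.continuous_cocycle.measurable.comp hpair
  have hac (g : G) : Continuous (a g) := (F g).continuous_act_right
  have hσc (g : G) : Continuous (σ g) := (F g).continuous_cocycle_right
  have hsup : Measurable fun g => ⨆ x : Dir d, ‖(F g).cocycle x‖ₑ :=
    PosHom.measurable_iSup_enorm_cocycle.comp hF
  have hZm : Measurable Z := hsup.ennreal_toReal
  have hZ : Integrable Z μ := integrable_toReal_of_lintegral_ne_top hsup.aemeasurable hmom.ne
  have hσZ (g : G) (x : Dir d) : |σ g x| ≤ Z g := by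
    have h := ENNReal.toReal_mono (F g).iSup_enorm_cocycle_lt_top.ne
      (le_iSup (fun x => ‖(F g).cocycle x‖ₑ) x)
    rwa [toReal_enorm] at h
  have huniq' (ν' : Measure (Dir d)) (h1 : IsProbabilityMeasure ν')
      (h2 : ∀ h : C(Dir d, ℝ), ∫ x, ∫ g, h (a g x) ∂μ ∂ν' = ∫ x, h x ∂ν') : ν' = ν :=
    hν ν' ⟨h1, h2⟩
  refine ⟨∫ y, ∫ g, σ g y ∂μ ∂ν, fun x₀ hx₀ => ?_, ?_, fun ν' h1 h2 => ?_⟩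
  · filter_upwards [ae_tendsto_walkSum_div_of_unique ha hac huniq' hσ hσc hZm hZ hσZ
      (Quotient.mk (dirSetoid d) ⟨x₀, hx₀⟩)] with ω hω
    have h := hω.add (tendsto_const_div_atTop_nhds_zero_nat (Real.log ‖x₀‖))
    rw [add_zero] at h
    refine h.congr fun ℓ => ?_
    rw [← add_div, ← log_norm_orbit_sub F ω hx₀, sub_add_cancel, one_div_mul_eq_div]
  · refine ENNReal.tendsto_nhds_zero.2 fun ε hε => ?_
    obtain ⟨δ, -, hδ0, hδε⟩ := ENNReal.lt_iff_exists_real_btwn.1 hε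
    obtain ⟨N, hN⟩ := exists_lintegral_walkSum_div_le ha hac huniq' hσ hσc hZm hZ hσZ
      (ENNReal.ofReal_pos.1 hδ0)
    filter_upwards [eventually_ge_atTop N] with ℓ hℓ
    refine iSup_le fun x₀ => ?_
    simp only [log_norm_orbit_sub F _ x₀.2, one_div_mul_eq_div]
    exact (hN ℓ hℓ _).trans hδε.le
  · obtain rfl := hν ν' ⟨h1, h2⟩
    have hi : Integrable (fun p : G × Dir d => (F p.1).cocycle p.2) (μ.prod ν') :=
      (hZ.comp_fst ν').mono' hσ.aestronglyMeasurable (ae_of_all _ fun p => hσZ p.1 p.2)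
    exact ⟨hi, (integral_prod_symm _ hi).symm⟩

end RandomProduct

/-! ### Leaky ReLU layers -/

section LeakyLayer

variable {d : ℕ} {α₁ α₂ : ℝ}

theorem continuous_layer (h₁ : α₁ ≠ 0) (h₂ : α₂ ≠ 0) :
    Continuous (layer (d := d) h₁ h₂) := by
  refine continuous_induced_rng.2 (ContinuousMap.continuous_of_continuous_uncurry _ ?_)
  have hW : Continuous fun p : GL (Fin d) ℝ × Metric.sphere (0 : Euc d) 1 =>
      (p.1 : Matrix (Fin d) (Fin d) ℝ) := Units.continuous_val.comp continuous_fst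
  change Continuous fun p : GL (Fin d) ℝ × Metric.sphere (0 : Euc d) 1 =>
    layerFun α₁ α₂ p.1 (p.2 : Euc d)
  unfold layerFun leaky
  have hm : Continuous fun p : GL (Fin d) ℝ × Metric.sphere (0 : Euc d) 1 =>
      Matrix.mulVec (p.1 : Matrix (Fin d) (Fin d) ℝ) (p.2 : Euc d).ofLp :=
    hW.matrix_mulVec (by fun_prop)
  fun_prop

theorem abs_leaky_le (α₁ α₂ t : ℝ) : |leaky α₁ α₂ t| ≤ max |α₁| |α₂| * |t| := by
  unfold leaky
  rcases max_choice (α₁ * t) (α₂ * t) with h | h <;> rw [h, abs_mul] <;> gcongr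
  exacts [le_max_left _ _, le_max_right _ _]

theorem le_abs_leaky (α₁ α₂ t : ℝ) : min |α₁| |α₂| * |t| ≤ |leaky α₁ α₂ t| := by
  unfold leaky
  rcases max_choice (α₁ * t) (α₂ * t) with h | h <;> rw [h, abs_mul] <;> gcongr
  exacts [min_le_left _ _, min_le_right _ _]

theorem norm_le_mul_norm_of_forall_abs_le {x y : Euc d} {c : ℝ} (hc : 0 ≤ c)
    (h : ∀ i, |x i| ≤ c * |y i|) : ‖x‖ ≤ c * ‖y‖ := by
  rw [EuclideanSpace.norm_eq, EuclideanSpace.norm_eq, ← Real.sqrt_sq hc,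
    ← Real.sqrt_mul (sq_nonneg c), Finset.mul_sum]
  refine Real.sqrt_le_sqrt (Finset.sum_le_sum fun i _ => ?_)
  rw [← mul_pow]
  exact pow_le_pow_left₀ (norm_nonneg _) (h i) 2

theorem norm_layerFun_le (W : GL (Fin d) ℝ) (x : Euc d) :
    ‖layerFun α₁ α₂ W x‖ ≤ max |α₁| |α₂| * (normN W * ‖x‖) := by
  have hc : 0 ≤ max |α₁| |α₂| := (abs_nonneg α₁).trans (le_max_left _ _)
  refine (norm_le_mul_norm_of_forall_abs_le (y := Matrix.toEuclideanCLM (𝕜 := ℝ)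
    (W : Matrix (Fin d) (Fin d) ℝ) x) hc fun i => abs_leaky_le α₁ α₂ _).trans ?_
  refine mul_le_mul_of_nonneg_left ((ContinuousLinearMap.le_opNorm _ x).trans ?_) hc
  exact mul_le_mul_of_nonneg_right (le_max_left _ _) (norm_nonneg x)

theorem le_norm_layerFun (h₁ : α₁ ≠ 0) (h₂ : α₂ ≠ 0) (W : GL (Fin d) ℝ) (x : Euc d) :
    min |α₁| |α₂| * ‖x‖ ≤ normN W * ‖layerFun α₁ α₂ W x‖ := by
  have hc : 0 < min |α₁| |α₂| := lt_min (abs_pos.2 h₁) (abs_pos.2 h₂)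
  set y : Euc d := Matrix.toEuclideanCLM (𝕜 := ℝ) (W : Matrix (Fin d) (Fin d) ℝ) x with hy
  have hxy : ‖x‖ ≤ normN W * ‖y‖ := by
    have hx : Matrix.toEuclideanCLM (𝕜 := ℝ)
        ((W⁻¹ : GL (Fin d) ℝ) : Matrix (Fin d) (Fin d) ℝ) y = x := by
      rw [hy, ← mul_apply_eq_comp, ← map_mul, Units.inv_mul, map_one,
        one_apply_eq_self]
    conv_lhs => rw [← hx]
    exact (ContinuousLinearMap.le_opNorm _ y).trans
      (mul_le_mul_of_nonneg_right (le_max_right _ _) (norm_nonneg y))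
  have hyl : ‖y‖ ≤ (min |α₁| |α₂|)⁻¹ * ‖layerFun α₁ α₂ W x‖ := by
    refine norm_le_mul_norm_of_forall_abs_le (inv_nonneg.2 hc.le) fun i => ?_
    rw [le_inv_mul_iff₀ hc]
    exact le_abs_leaky α₁ α₂ _
  have hN : 0 ≤ normN W := (norm_nonneg _).trans (le_max_left _ _)
  calc min |α₁| |α₂| * ‖x‖ ≤ min |α₁| |α₂| * (normN W * ‖y‖) := by gcongr
    _ = normN W * (min |α₁| |α₂| * ‖y‖) := by ring
    _ ≤ normN W * ‖layerFun α₁ α₂ W x‖ := by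
      gcongr
      rwa [le_inv_mul_iff₀ hc] at hyl

/-- The cocycle of a layer is bounded by `log N(W)` up to a constant depending on the activation. -/
theorem abs_cocycle_layer_le (h₁ : α₁ ≠ 0) (h₂ : α₂ ≠ 0) (W : GL (Fin d) ℝ) (x : Dir d) :
    |(layer h₁ h₂ W).cocycle x| ≤
      |Real.log (max |α₁| |α₂|)| + |Real.log (min |α₁| |α₂|)| + Real.log (normN W) := by
  have hm : 0 < min |α₁| |α₂| := lt_min (abs_pos.2 h₁) (abs_pos.2 h₂)
  have hM : 0 < max |α₁| |α₂| := lt_max_of_lt_left (abs_pos.2 h₁)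
  rw [PosHom.cocycle_eq]
  have hu := norm_eq_of_mem_sphere (Dir.toSphere x)
  have hne : 0 < ‖layerFun α₁ α₂ W (Dir.toSphere x : Euc d)‖ :=
    norm_pos_iff.2 ((layer h₁ h₂ W).apply_toSphere_ne_zero x)
  have hup := norm_layerFun_le (α₁ := α₁) (α₂ := α₂) W (Dir.toSphere x : Euc d)
  have hlo := le_norm_layerFun h₁ h₂ W (Dir.toSphere x : Euc d)
  rw [hu, mul_one] at hup hlo
  have hN : 0 < normN W := pos_of_mul_pos_left (hm.trans_le hlo) hne.le
  have hup' := Real.log_le_log hne hup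
  have hlo' := Real.log_le_log hm hlo
  rw [Real.log_mul hM.ne' hN.ne'] at hup'
  rw [Real.log_mul hN.ne' hne.ne'] at hlo'
  change |Real.log ‖layerFun α₁ α₂ W (Dir.toSphere x : Euc d)‖| ≤ _
  have e1 := abs_nonneg (Real.log (max |α₁| |α₂|))
  have e2 := abs_nonneg (Real.log (min |α₁| |α₂|))
  have e3 := le_abs_self (Real.log (max |α₁| |α₂|))
  have e4 := neg_abs_le (Real.log (min |α₁| |α₂|))
  exact abs_le.2 ⟨by linarith, by linarith⟩

theorem lintegral_iSup_enorm_cocycle_layer_lt_top (h₁ : α₁ ≠ 0) (h₂ : α₂ ≠ 0)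
    (μ : Measure (GL (Fin d) ℝ)) [IsFiniteMeasure μ]
    (hμ : Integrable (fun W => Real.log (normN W)) μ) :
    ∫⁻ W, ⨆ x : Dir d, ‖(layer h₁ h₂ W).cocycle x‖ₑ ∂μ < ∞ := by
  have hi := (integrable_const
    (|Real.log (max |α₁| |α₂|)| + |Real.log (min |α₁| |α₂|)|)).add hμ
  refine (lintegral_mono fun W => iSup_le fun x => ?_).trans_lt hi.hasFiniteIntegral
  refine enorm_le_iff_norm_le.2 ?_
  exact (abs_cocycle_layer_le h₁ h₂ W x).trans (le_abs_self _)

end LeakyLayer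

end HomLLN

theorem theoremC5 (d : ℕ) :
    -- the law of large numbers for positively homogeneous maps
    (∀ (η : Measure (PosHom d)) [IsProbabilityMeasure η],
      (∃! ν : Measure (Dir d), IsProbabilityMeasure ν ∧ IsSphericalStationary id η ν) →
      (∫⁻ f, ⨆ x : Dir d, ‖f.cocycle x‖ₑ ∂η < ∞) →
      ∃ lam : ℝ,
        (∀ x₀ : Euc d, x₀ ≠ 0 →
          ∀ᵐ ω ∂(Measure.infinitePi fun _ : ℕ => η),
            Tendsto (fun ℓ : ℕ => 1 / (ℓ : ℝ) * Real.log ‖orbit id ω x₀ ℓ‖) atTop (𝓝 lam)) ∧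
        Tendsto (fun ℓ : ℕ => ⨆ x₀ : {x : Euc d // x ≠ 0},
            ∫⁻ ω, ‖1 / (ℓ : ℝ) *
                (Real.log ‖orbit id ω (x₀ : Euc d) ℓ‖ - Real.log ‖(x₀ : Euc d)‖) - lam‖ₑ
              ∂(Measure.infinitePi fun _ : ℕ => η))
          atTop (𝓝 0) ∧
        ∀ ν : Measure (Dir d), IsProbabilityMeasure ν → IsSphericalStationary id η ν →
          Integrable (fun p : PosHom d × Dir d => p.1.cocycle p.2) (η.prod ν) ∧
          lam = ∫ p : PosHom d × Dir d, p.1.cocycle p.2 ∂(η.prod ν)) ∧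
    -- the law of large numbers for generalized Leaky ReLU networks
    (∀ (α₁ α₂ : ℝ) (h₁ : α₁ ≠ 0) (h₂ : α₂ ≠ 0)
      (μ : Measure (GL (Fin d) ℝ)) [IsProbabilityMeasure μ],
      (∃! ν : Measure (Dir d), IsProbabilityMeasure ν ∧ IsSphericalStationary (layer h₁ h₂) μ ν) →
      Integrable (fun W => Real.log (normN W)) μ →
      ∃ lam : ℝ,
        (∀ x₀ : Euc d, x₀ ≠ 0 →
          ∀ᵐ ω ∂(Measure.infinitePi fun _ : ℕ => μ),
            Tendsto (fun ℓ : ℕ => 1 / (ℓ : ℝ) * Real.log ‖orbit (layer h₁ h₂) ω x₀ ℓ‖)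
              atTop (𝓝 lam)) ∧
        Tendsto (fun ℓ : ℕ => ⨆ x₀ : {x : Euc d // x ≠ 0},
            ∫⁻ ω, ‖1 / (ℓ : ℝ) *
                (Real.log ‖orbit (layer h₁ h₂) ω (x₀ : Euc d) ℓ‖ - Real.log ‖(x₀ : Euc d)‖)
                - lam‖ₑ
              ∂(Measure.infinitePi fun _ : ℕ => μ))
          atTop (𝓝 0) ∧
        ∀ ν : Measure (Dir d), IsProbabilityMeasure ν → IsSphericalStationary (layer h₁ h₂) μ ν →
          Integrable (fun p : GL (Fin d) ℝ × Dir d => (layer h₁ h₂ p.1).cocycle p.2) (μ.prod ν) ∧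
          lam = ∫ p : GL (Fin d) ℝ × Dir d, (layer h₁ h₂ p.1).cocycle p.2 ∂(μ.prod ν)) := by
  refine ⟨fun η _ huniq hmom => lln_of_measurable_family measurable_id η huniq hmom,
    fun α₁ α₂ h₁ h₂ μ _ huniq hmom => ?_⟩
  exact lln_of_measurable_family (continuous_layer h₁ h₂).measurable μ huniq
    (lintegral_iSup_enorm_cocycle_layer_lt_top h₁ h₂ μ hmom)
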